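/- Let $(\mathcal R,\le,r)$ be a triple where $\le$ is a quasi order (reflexive and transitive) on the set $\mathcal R$ and $r:\mathbb N\times\mathcal R\to\mathcal{AR}$ is a surjection; write $r_n(A)=r(n,A)$ and $\mathcal{AR}_n=\{r_n(A):A\in\mathcal R\}$. For $a\in\mathcal{AR}$ and $A\in\mathcal R$ let $$[a,A]=\{B\in\mathcal R:\ B\le A\text{ and }a=r_n(B)\text{ for some }n\},\qquad [n,A]=[r_n(A),A],$$ and $\mathcal{AR}(A)=\{a\in\mathcal{AR}:[a,A]\ne\emptyset\}$. Assume: - (A.1) $r_0(A)$ is the same element of $\mathcal{AR}$, denoted $\emptyset$, for all $A\in\mathcal R$. - (A.2) If $A\ne B$ then $r_n(A)\ne r_n(B)$ for some $n$. - (A.3) If $r_n(A)=r_m(B)$ then $n=m$ and $r_i(A)=r_i(B)$ for all $i<n$. Let $|a|$ be the unique $n$ with $a\in\mathcal{AR}_n$. Assume further that there is a quasi order $\le_{\mathrm{fin}}$ on $\mathcal{AR}$ such that the following hold, where $\mathrm{depth}_A(a)=\min\{n: a\le_{\mathrm{fin}}r_n(A)\}$ for $A\in\mathcal R$ and $a\in\mathcal{AR}(A)$: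 - (A.4) $A\le B$ if and only if for every $n$ there is $m$ with $r_n(A)\le_{\mathrm{fin}}r_m(B)$; and $\{b\in\mathcal{AR}:b\le_{\mathrm{fin}}a\}$ is finite for every $a\in\mathcal{AR}$. - (A.5) If $a\in\mathcal{AR}(A)$ and $n=\mathrm{depth}_A(a)$, then $[a,B]\neq\emptyset$ for every $B\in[n,A]$, and for every $B\in[a,A]$ there is $A'\in[n,A]$ with $[a,A']\subseteq[a,B]$. - (A.6) If $a\in\mathcal{AR}(A)$ and $n=\mathrm{depth}_A(a)$, then for every $\mathcal O\subseteq\mathcal{AR}_{|a|+1}$ there is $B\in[n,A]$ such that $\{r_{|a|+1}(C):C\in[a,B]\}$ is contained in $\mathcal O$ or in its complement. Give $\mathcal{AR}$ the discrete topology and $\mathcal{AR}^{\mathbb N}$ the product topology, and identify $A\in\mathcal R$ with the sequence $(r_n(A))_{n\in\mathbb N}$; the metric topology of $\mathcal R$ is the subspace topology. Assume that $\mathcal R$ is metrically closed, that is, closed in $\mathcal{AR}^{\mathbb N}$. Then every Borel subset $\mathcal X$ of $\mathcal R$ with respect to the metric topology is Ramsey: for all $a\in\mathcal{AR}$ and $A\in\mathcal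 R$ with $[a,A]\neq\emptyset$ there is $B\in[a,A]$ such that $[a,B]\subseteq\mathcal X$ or $[a,B]\cap\mathcal X=\emptyset$. -/

import Mathlib

/-! Triples `(R, ≤, r)`: `≤` is a quasi order on `R` (a `Preorder`), and `r n A` is the `n`-th
approximation of `A`; the approximations form the type `AR`. -/

namespace RamseySpace

universe u v

variable {R : Type u} {AR : Type v}

/-- The set `AR_n` of all `n`-th approximations. -/
def approxLevel (r : ℕ → R → AR) (n : ℕ) : Set AR :=
  {a | ∃ A : R, r n A = a}

/-- The length `|a|`: the `n` with `a = r_n(A)` for some `A` (it exists when `r` is onto `AR`,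
and it is unique under (A.3)). -/
noncomputable def length (r : ℕ → R → AR) (a : AR) : ℕ :=
  sInf {n | a ∈ approxLevel r n}

/-- The neighborhood `[a, A]`. -/
def nbhd [Preorder R] (r : ℕ → R → AR) (a : AR) (A : R) : Set R :=
  {B | (∃ n, a = r n B) ∧ B ≤ A}

/-- The neighborhood `[n, A] = [r_n(A), A]`. -/
def nbhdNat [Preorder R] (r : ℕ → R → AR) (n : ℕ) (A : R) : Set R :=
  nbhd r (r n A) A

/-- The set `AR(A)` of those `a` with `[a, A] ≠ ∅`. -/
def approxBelow [Preorder R] (r : ℕ → R → AR) (A : R) : Set AR :=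
  {a | (nbhd r a A).Nonempty}

/-- `depth_A(a) = min {n : a ≤_fin r_n(A)}`; used for `a ∈ AR(A)` only, where the set is
nonempty by (A.4). -/
noncomputable def depth (r : ℕ → R → AR) (leFin : AR → AR → Prop) (A : R) (a : AR) : ℕ :=
  sInf {n | leFin a (r n A)}

/-- The map that identifies `A` with the sequence of its approximations. -/
def approxSeq (r : ℕ → R → AR) (A : R) : ℕ → AR :=
  fun n => r n A

/-- The product topology on `AR^ℕ`, with `AR` discrete. -/
abbrev seqTopology (AR : Type v) : TopologicalSpace (ℕ → AR) :=
  @Pi.topologicalSpace ℕ (fun _ => AR) (fun _ => ⊥)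

/-- The metric topology on `R`, inherited from `AR^ℕ`. -/
abbrev metricTopology (r : ℕ → R → AR) : TopologicalSpace R :=
  TopologicalSpace.induced (approxSeq r) (seqTopology AR)

/-- `R` is a closed subspace of `AR^ℕ`. -/
def MetricallyClosed (r : ℕ → R → AR) : Prop :=
  @IsClosed (ℕ → AR) (seqTopology AR) (Set.range (approxSeq r))

/-- The Borel sets of the metric topology. -/
def MetricBorel (r : ℕ → R → AR) (X : Set R) : Prop :=
  @MeasurableSet R (@borel R (metricTopology r)) X

/-- (A.1): all `A` have the same `0`-th approximation (the one called `∅`). -/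
def AxiomA1 (r : ℕ → R → AR) : Prop :=
  ∀ A B : R, r 0 A = r 0 B

/-- (A.2) -/
def AxiomA2 (r : ℕ → R → AR) : Prop :=
  ∀ A B : R, A ≠ B → ∃ n, r n A ≠ r n B

/-- (A.3) -/
def AxiomA3 (r : ℕ → R → AR) : Prop :=
  ∀ (n m : ℕ) (A B : R), r n A = r m B → n = m ∧ ∀ i < n, r i A = r i B

/-- (A.4) Finitization, for the relation `leFin`. -/
structure AxiomA4 [Preorder R] (r : ℕ → R → AR) (leFin : AR → AR → Prop) : Prop where
  refl : ∀ a, leFin a a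
  trans : ∀ a b c, leFin a b → leFin b c → leFin a c
  le_iff : ∀ A B : R, A ≤ B ↔ ∀ n, ∃ m, leFin (r n A) (r m B)
  finite : ∀ a, {b | leFin b a}.Finite

/-- (A.5) Amalgamation. -/
def AxiomA5 [Preorder R] (r : ℕ → R → AR) (leFin : AR → AR → Prop) : Prop :=
  ∀ (A : R) (a : AR) (n : ℕ), a ∈ approxBelow r A → depth r leFin A a = n →
    (∀ B ∈ nbhdNat r n A, (nbhd r a B).Nonempty) ∧
    (∀ B ∈ nbhd r a A, ∃ A' ∈ nbhdNat r n A, nbhd r a A' ⊆ nbhd r a B)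

/-- (A.6) Pigeon hole principle. -/
def AxiomA6 [Preorder R] (r : ℕ → R → AR) (leFin : AR → AR → Prop) : Prop :=
  ∀ (A : R) (a : AR) (n : ℕ), a ∈ approxBelow r A → depth r leFin A a = n →
    ∀ O : Set AR, O ⊆ approxLevel r (length r a + 1) →
      ∃ B ∈ nbhdNat r n A,
        r (length r a + 1) '' nbhd r a B ⊆ O ∨ r (length r a + 1) '' nbhd r a B ⊆ Oᶜ

/-- Ramsey subsets of `R`. -/
def IsRamsey [Preorder R] (r : ℕ → R → AR) (X : Set R) : Prop :=
  ∀ (a : AR) (A : R), (nbhd r a A).Nonempty →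
    ∃ B ∈ nbhd r a A, nbhd r a B ⊆ X ∨ nbhd r a B ∩ X = ∅

end RamseySpace

/-! Fix `a` and `A` with `[a, A] ≠ ∅`. Combinatorial forcing shrinks `A` to some `B` that decides,
for every end-extension `b` of `a` at once, an open set or the first `|b| + 1` sets of a sequence
of Ramsey sets; in the second case the union of the sequence agrees on `[a, B]` with an open set.
The shrinking is a fusion that treats the `b` in the order of their depth. Depth need not increase
along end-extensions, so the fusion keeps the first `n` approximations fixed, where `n` is the
least depth of an end-extension of `a`, and not the depth of `a`: by (A.5) an end-extension of
depth `n` survives in every `B ∈ [n, A]`, and then so does `a`. -/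

namespace RamseySpace

open scoped Topology

variable {R AR : Type*} {r : ℕ → R → AR}

theorem AxiomA3.length_approx (h3 : AxiomA3 r) (n : ℕ) (A : R) : length r (r n A) = n := by
  have hlevel : {m | r n A ∈ approxLevel r m} = {n} := by
    ext m
    exact ⟨fun ⟨_, hB⟩ => (h3 _ _ _ _ hB).1, fun hm => ⟨A, by rw [hm]⟩⟩
  rw [length, hlevel, csInf_singleton]

theorem AxiomA3.approx_eq_of_le (h3 : AxiomA3 r) {A B : R} {n i : ℕ} (h : r n A = r n B)
    (hi : i ≤ n) : r i A = r i B := by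
  obtain hi | rfl := hi.lt_or_eq
  exacts [(h3 n n A B h).2 i hi, h]

theorem AxiomA3.isOpen_metricTopology_iff (h3 : AxiomA3 r) {X : Set R} :
    IsOpen[metricTopology r] X ↔ ∀ D ∈ X, ∃ n, ∀ E, r n E = r n D → E ∈ X := by
  let _ : TopologicalSpace AR := ⊥
  have : DiscreteTopology AR := ⟨rfl⟩
  let _ : TopologicalSpace R := metricTopology r
  have hbasis := (PiNat.isTopologicalBasis_cylinders fun _ : ℕ => AR).induced (approxSeq r)
  constructor
  · intro hX D hD
    obtain ⟨_, ⟨_, ⟨x, n, rfl⟩, rfl⟩, hDx, hsub⟩ := hbasis.exists_subset_of_mem_open hD hX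
    refine ⟨n, fun E hE => hsub fun i hi => ?_⟩
    exact (h3.approx_eq_of_le hE hi.le).trans (hDx i hi)
  · intro hX
    refine hbasis.isOpen_iff.2 fun D hD => ?_
    obtain ⟨n, hn⟩ := hX D hD
    exact ⟨_, ⟨_, ⟨approxSeq r D, n + 1, rfl⟩, rfl⟩, PiNat.self_mem_cylinder _ _,
      fun E hE => hn E (hE n n.lt_succ_self)⟩

theorem MetricallyClosed.exists_approx_eq (hclosed : MetricallyClosed r) {x : ℕ → AR}
    {T : ℕ → R} (hT : ∀ N, ∀ i ≤ N, r i (T N) = x i) : ∃ B, ∀ i, r i B = x i := by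
  let _ : TopologicalSpace AR := ⊥
  have hlim : Filter.Tendsto (fun N => approxSeq r (T N)) Filter.atTop (nhds x) :=
    tendsto_pi_nhds.2 fun i => tendsto_const_nhds.congr' <|
      (Filter.eventually_ge_atTop i).mono fun N hN => (hT N i hN).symm
  obtain ⟨B, hB⟩ := IsClosed.mem_of_tendsto hclosed hlim (.of_forall fun N => ⟨T N, rfl⟩)
  exact ⟨B, congrFun hB⟩

/-- `a ⊑ b`: `a` is an initial segment of `b`, that is, `b` is an end-extension of `a`. -/
def IsInitial (r : ℕ → R → AR) (a b : AR) : Prop :=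
  ∃ D j k, j ≤ k ∧ r j D = a ∧ r k D = b

theorem isInitial_approx (D : R) {j k : ℕ} (hjk : j ≤ k) : IsInitial r (r j D) (r k D) :=
  ⟨D, j, k, hjk, rfl, rfl⟩

/-- The set `s` decides membership in `X`: its points all lie in `X`, or none does. -/
def Decides (s X : Set R) : Prop :=
  s ⊆ X ∨ s ∩ X = ∅

theorem Decides.mono {s t X : Set R} (h : Decides t X) (hst : s ⊆ t) : Decides s X :=
  h.imp hst.trans fun ht => Set.subset_eq_empty (Set.inter_subset_inter_left X hst) ht

theorem Decides.compl {s X : Set R} (h : Decides s X) : Decides s Xᶜ :=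
  h.symm.imp (fun hs => (Set.disjoint_iff_inter_eq_empty.2 hs).subset_compl_right)
    fun hs => Set.sdiff_eq_empty.2 hs

section Preorder

variable [Preorder R] {leFin : AR → AR → Prop} {A B C D : R} {a b : AR}

theorem nbhd_mono (h : B ≤ A) : nbhd r a B ⊆ nbhd r a A :=
  fun _ hC => ⟨hC.1, hC.2.trans h⟩

theorem approxBelow_mono (h : B ≤ A) : approxBelow r B ⊆ approxBelow r A :=
  fun _ ha => ha.mono (nbhd_mono h)

theorem nbhd_subset_of_mem (h : B ∈ nbhd r a A) : nbhd r a B ⊆ nbhd r a A :=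
  nbhd_mono h.2

theorem mem_nbhd_self (h : B ∈ nbhd r a A) : B ∈ nbhd r a B :=
  ⟨h.1, le_rfl⟩

theorem mem_nbhd_approx {n : ℕ} (h : B ≤ A) : B ∈ nbhd r (r n B) A :=
  ⟨⟨n, rfl⟩, h⟩

theorem isInitial_refl (ha : a ∈ approxBelow r A) : IsInitial r a a := by
  obtain ⟨D, ⟨n, rfl⟩, -⟩ := ha
  exact isInitial_approx D le_rfl

theorem AxiomA3.mem_nbhd (h3 : AxiomA3 r) {n : ℕ} :
    B ∈ nbhd r (r n D) A ↔ r n B = r n D ∧ B ≤ A := by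
  refine ⟨?_, fun ⟨h, hB⟩ => ⟨⟨n, h.symm⟩, hB⟩⟩
  rintro ⟨⟨m, hm⟩, hB⟩
  obtain rfl := (h3 _ _ _ _ hm).1
  exact ⟨hm.symm, hB⟩

theorem AxiomA3.mem_nbhdNat (h3 : AxiomA3 r) {n : ℕ} :
    B ∈ nbhdNat r n A ↔ r n B = r n A ∧ B ≤ A :=
  h3.mem_nbhd

theorem AxiomA3.nbhdNat_trans (h3 : AxiomA3 r) {m n : ℕ} (hmn : m ≤ n)
    (hB : B ∈ nbhdNat r m A) (hC : C ∈ nbhdNat r n B) : C ∈ nbhdNat r m A := by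
  rw [h3.mem_nbhdNat] at *
  exact ⟨(h3.approx_eq_of_le hC.1 hmn).trans hB.1, hC.2.trans hB.2⟩

theorem AxiomA3.nbhd_subset_of_isInitial (h3 : AxiomA3 r) (hab : IsInitial r a b) :
    nbhd r b A ⊆ nbhd r a A := by
  obtain ⟨D, j, k, hjk, rfl, rfl⟩ := hab
  intro E hE
  rw [h3.mem_nbhd] at hE ⊢
  exact ⟨h3.approx_eq_of_le hE.1 hjk, hE.2⟩

theorem AxiomA3.isInitial_approx_succ (h3 : AxiomA3 r) (hab : IsInitial r a b)
    (hB : B ∈ nbhd r b A) : IsInitial r a (r (length r b + 1) B) := by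
  obtain ⟨D, j, k, hjk, rfl, rfl⟩ := hab
  rw [h3.length_approx, ← h3.approx_eq_of_le (h3.mem_nbhd.1 hB).1 hjk]
  exact isInitial_approx B (hjk.trans k.le_succ)

theorem AxiomA4.leFin_depth (h4 : AxiomA4 r leFin) (hb : b ∈ approxBelow r A) :
    leFin b (r (depth r leFin A b) A) := by
  obtain ⟨D, ⟨j, rfl⟩, hD⟩ := hb
  exact Nat.sInf_mem ((h4.le_iff D A).1 hD j)

theorem depth_eq_of_approx_eq (h3 : AxiomA3 r) (h4 : AxiomA4 r leFin) {m : ℕ}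
    (hb : b ∈ approxBelow r A) (hm : depth r leFin A b ≤ m) (hBA : r m B = r m A) :
    depth r leFin B b = depth r leFin A b := by
  have hB : leFin b (r (depth r leFin A b) B) := by
    rw [h3.approx_eq_of_le hBA hm]
    exact h4.leFin_depth hb
  have hle : depth r leFin B b ≤ depth r leFin A b := Nat.sInf_le hB
  refine hle.antisymm (Nat.sInf_le ?_)
  change leFin b (r _ A)
  rw [← h3.approx_eq_of_le hBA (hle.trans hm)]
  exact Nat.sInf_mem (s := {n | leFin b (r n B)}) ⟨_, hB⟩

theorem le_depth_of_mem_nbhdNat (h3 : AxiomA3 r) (h4 : AxiomA4 r leFin) {n : ℕ}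
    (hB : B ∈ nbhdNat r n A) (hb : b ∈ approxBelow r B) (hn : n ≤ depth r leFin A b) :
    n ≤ depth r leFin B b := by
  by_contra! hlt
  have := depth_eq_of_approx_eq h3 h4 hb hlt.le (h3.mem_nbhdNat.1 hB).1.symm
  omega

theorem exists_fusion_limit (hclosed : MetricallyClosed r) (h3 : AxiomA3 r)
    (h4 : AxiomA4 r leFin) {T : ℕ → R} {n : ℕ} (hT : ∀ k, T (k + 1) ∈ nbhdNat r (n + k) (T k)) :
    ∃ B, ∀ k, B ∈ nbhdNat r (n + k) (T k) := by
  have hchain : ∀ {k l}, k ≤ l → T l ∈ nbhdNat r (n + k) (T k) := by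
    intro k l hkl
    induction l, hkl using Nat.le_induction with
    | base => exact mem_nbhd_approx le_rfl
    | succ l hkl ih => exact h3.nbhdNat_trans (by omega) ih (hT l)
  have hagree : ∀ {k l i}, k ≤ l → i ≤ n + k → r i (T l) = r i (T k) := fun hkl hi =>
    h3.approx_eq_of_le (h3.mem_nbhdNat.1 (hchain hkl)).1 hi
  obtain ⟨B, hB⟩ := hclosed.exists_approx_eq (x := fun i => r i (T i)) (T := T)
    fun N i hi => hagree hi (by omega)
  have hBT : ∀ {k i}, i ≤ n + k → r i B = r i (T k) := by
    intro k i hi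
    rw [hB]
    obtain hki | hik := le_total k i
    · exact hagree hki hi
    · exact (hagree hik (by omega)).symm
  refine ⟨B, fun k => h3.mem_nbhdNat.2 ⟨hBT le_rfl, (h4.le_iff _ _).2 fun i => ?_⟩⟩
  rw [hBT (k := max i k) (by omega)]
  exact (h4.le_iff _ _).1 (hchain (le_max_right i k)).2 i

section Fusion

variable {P : AR → Set R → Prop}

theorem exists_fusion_stage (h3 : AxiomA3 r) (h4 : AxiomA4 r leFin) (h5 : AxiomA5 r leFin)
    (hanti : ∀ b, Antitone (P b))
    (hdense : ∀ b, ∀ B ≤ A, b ∈ approxBelow r B → ∃ C ∈ nbhd r b B, P b (nbhd r b C)) (m : ℕ) :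
    ∃ B ∈ nbhdNat r m A, ∀ b ∈ approxBelow r B, depth r leFin A b = m → P b (nbhd r b B) := by
  have hfinite : ∀ F : Set AR, F.Finite → ∃ B ∈ nbhdNat r m A,
      ∀ b ∈ F, b ∈ approxBelow r B → depth r leFin A b = m → P b (nbhd r b B) := by
    intro F hF
    induction F, hF using Set.Finite.induction_on with
    | empty => exact ⟨A, mem_nbhd_approx le_rfl, fun _ hb => hb.elim⟩
    | @insert c F _ _ ih =>
      obtain ⟨B, hB, hPB⟩ := ih
      by_cases hc : c ∈ approxBelow r B ∧ depth r leFin A c = m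
      · obtain ⟨hcB, hcm⟩ := hc
        have hBA := h3.mem_nbhdNat.1 hB
        have hdepth : depth r leFin B c = m :=
          (depth_eq_of_approx_eq h3 h4 (approxBelow_mono hBA.2 hcB) hcm.le hBA.1).trans hcm
        obtain ⟨C, hC, hPC⟩ := hdense c B hBA.2 hcB
        obtain ⟨B', hB', hsub⟩ := (h5 B c m hcB hdepth).2 C hC
        refine ⟨B', h3.nbhdNat_trans le_rfl hB hB', ?_⟩
        rintro b (rfl | hbF) hb hbm
        · exact hanti b hsub hPC
        · exact hanti b (nbhd_mono hB'.2) (hPB b hbF (approxBelow_mono hB'.2 hb) hbm)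
      · refine ⟨B, hB, ?_⟩
        rintro b (rfl | hbF) hb hbm
        · exact absurd ⟨hb, hbm⟩ hc
        · exact hPB b hbF hb hbm
  obtain ⟨B, hB, hPB⟩ := hfinite _ (h4.finite (r m A))
  refine ⟨B, hB, fun b hb hbm => hPB b ?_ hb hbm⟩
  exact hbm ▸ h4.leFin_depth (approxBelow_mono hB.2 hb)

theorem exists_fusion_nbhdNat (hclosed : MetricallyClosed r) (h3 : AxiomA3 r)
    (h4 : AxiomA4 r leFin) (h5 : AxiomA5 r leFin) (hanti : ∀ b, Antitone (P b))
    (hdense : ∀ b, ∀ B ≤ A, b ∈ approxBelow r B → ∃ C ∈ nbhd r b B, P b (nbhd r b C)) (n : ℕ) :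
    ∃ B ∈ nbhdNat r n A, ∀ b ∈ approxBelow r B, n ≤ depth r leFin A b → P b (nbhd r b B) := by
  have hstage : ∀ C ≤ A, ∀ m, ∃ D ∈ nbhdNat r m C,
      ∀ b ∈ approxBelow r D, depth r leFin C b = m → P b (nbhd r b D) := fun C hC m =>
    exists_fusion_stage h3 h4 h5 hanti (fun b B hB => hdense b B (hB.trans hC)) m
  choose! f hf hfP using hstage
  let T : ℕ → R := fun k => Nat.rec A (fun k C => f C (n + k)) k
  have hTA : ∀ k, T k ≤ A := by
    intro k
    induction k with
    | zero => exact le_rfl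
    | succ k ih => exact (hf (T k) ih (n + k)).2.trans ih
  obtain ⟨B, hB⟩ := exists_fusion_limit hclosed h3 h4 fun k => hf (T k) (hTA k) (n + k)
  refine ⟨B, hB 0, fun b hb hn => ?_⟩
  obtain ⟨k, hk⟩ := Nat.exists_eq_add_of_le (le_depth_of_mem_nbhdNat h3 h4 (hB 0) hb hn)
  have hdepth : depth r leFin (T k) b = n + k :=
    (depth_eq_of_approx_eq h3 h4 hb hk.le (h3.mem_nbhdNat.1 (hB k)).1.symm).trans hk
  have hBT : B ≤ T (k + 1) := (hB (k + 1)).2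
  exact hanti b (nbhd_mono hBT) (hfP (T k) (hTA k) (n + k) b (approxBelow_mono hBT hb) hdepth)

theorem exists_fusion (hclosed : MetricallyClosed r) (h3 : AxiomA3 r) (h4 : AxiomA4 r leFin)
    (h5 : AxiomA5 r leFin) (ha : a ∈ approxBelow r A) (hanti : ∀ b, Antitone (P b))
    (hdense : ∀ b, IsInitial r a b → ∀ B ≤ A, b ∈ approxBelow r B →
      ∃ C ∈ nbhd r b B, P b (nbhd r b C)) :
    ∃ B ≤ A, a ∈ approxBelow r B ∧
      ∀ b, IsInitial r a b → b ∈ approxBelow r B → P b (nbhd r b B) := by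
  obtain ⟨b₀, hb₀⟩ := exists_minimalFor_of_wellFoundedLT
    (fun b => IsInitial r a b ∧ b ∈ approxBelow r A) (depth r leFin A) ⟨a, isInitial_refl ha, ha⟩
  obtain ⟨B, hB, hPB⟩ := exists_fusion_nbhdNat (P := fun b s => IsInitial r a b → P b s)
    hclosed h3 h4 h5 (fun b _ _ hst h hab => hanti b hst (h hab))
    (fun b B hBA hb => by
      by_cases hab : IsInitial r a b
      · obtain ⟨C, hC, hPC⟩ := hdense b hab B hBA hb
        exact ⟨C, hC, fun _ => hPC⟩
      · exact ⟨hb.some, hb.some_mem, fun h => absurd h hab⟩)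
    (depth r leFin A b₀)
  have hb₀B : b₀ ∈ approxBelow r B := (h5 A b₀ _ hb₀.prop.2 rfl).1 B hB
  refine ⟨B, hB.2, hb₀B.mono (h3.nbhd_subset_of_isInitial hb₀.prop.1), fun b hab hb => ?_⟩
  exact hPB b hb (hb₀.le ⟨hab, approxBelow_mono hB.2 hb⟩) hab

end Fusion

theorem isRamsey_of_exists_le {X : Set R}
    (h : ∀ a A, a ∈ approxBelow r A → ∃ B ≤ A, a ∈ approxBelow r B ∧ Decides (nbhd r a B) X) :
    IsRamsey r X := by
  intro a A ha
  obtain ⟨B, hBA, ⟨C, hC⟩, hB⟩ := h a A ha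
  exact ⟨C, nbhd_mono hBA hC, hB.mono (nbhd_subset_of_mem hC)⟩

theorem IsRamsey.compl {X : Set R} (hX : IsRamsey r X) : IsRamsey r Xᶜ := fun a A ha =>
  have ⟨B, hB, h⟩ := hX a A ha
  ⟨B, hB, Decides.compl h⟩

theorem exists_approx_succ_mem_or_notMem (h5 : AxiomA5 r leFin) (h6 : AxiomA6 r leFin)
    (hb : b ∈ approxBelow r A) (O : Set AR) : ∃ C ∈ nbhd r b A,
      (∀ E ∈ nbhd r b C, r (length r b + 1) E ∈ O) ∨
        ∀ E ∈ nbhd r b C, r (length r b + 1) E ∉ O := by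
  obtain ⟨B, hB, hO⟩ := h6 A b _ hb rfl (O ∩ approxLevel r (length r b + 1)) Set.inter_subset_right
  obtain ⟨C, hC⟩ := (h5 A b _ hb rfl).1 B hB
  refine ⟨C, nbhd_mono hB.2 hC, hO.imp (fun h E hE => ?_) fun h E hE hEO => ?_⟩
  · exact (h ⟨E, nbhd_subset_of_mem hC hE, rfl⟩).1
  · exact h ⟨E, nbhd_subset_of_mem hC hE, rfl⟩ ⟨hEO, E, rfl⟩

/-- `B` rejects `b`, in the terminology of combinatorial forcing for the set `X`: no `D ∈ [b, B]`
accepts `b`, where `D` accepts `b` if `[b, D] ⊆ X`. -/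
def Rejects (r : ℕ → R → AR) (X : Set R) (b : AR) (B : R) : Prop :=
  ∀ D ∈ nbhd r b B, ¬ nbhd r b D ⊆ X

theorem exists_forall_accepts_or_rejects (hclosed : MetricallyClosed r) (h3 : AxiomA3 r)
    (h4 : AxiomA4 r leFin) (h5 : AxiomA5 r leFin) (ha : a ∈ approxBelow r A) (X : Set R) :
    ∃ B ≤ A, a ∈ approxBelow r B ∧
      ∀ b, IsInitial r a b → b ∈ approxBelow r B → nbhd r b B ⊆ X ∨ Rejects r X b B := by
  refine exists_fusion (P := fun b s => s ⊆ X ∨ ∀ D ∈ s, ¬ nbhd r b D ⊆ X) hclosed h3 h4 h5 ha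
    (fun b s t hst => Or.imp hst.trans fun h D hD => h D (hst hD)) fun b _ B _ hb => ?_
  by_cases hacc : ∃ D ∈ nbhd r b B, nbhd r b D ⊆ X
  · obtain ⟨D, hD, hDX⟩ := hacc
    exact ⟨D, hD, Or.inl hDX⟩
  · push Not at hacc
    obtain ⟨C, hC⟩ := hb
    exact ⟨C, hC, Or.inr fun D hD => hacc D (nbhd_subset_of_mem hC hD)⟩

variable {X : Set R}

theorem exists_forall_rejects_succ (hclosed : MetricallyClosed r) (h3 : AxiomA3 r)
    (h4 : AxiomA4 r leFin) (h5 : AxiomA5 r leFin) (h6 : AxiomA6 r leFin)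
    (ha : a ∈ approxBelow r B)
    (hB : ∀ b, IsInitial r a b → b ∈ approxBelow r B → nbhd r b B ⊆ X ∨ Rejects r X b B) :
    ∃ C ≤ B, a ∈ approxBelow r C ∧ ∀ b, IsInitial r a b → Rejects r X b B →
      ∀ E ∈ nbhd r b C, Rejects r X (r (length r b + 1) E) B := by
  obtain ⟨C, hCB, haC, hC⟩ := exists_fusion
    (P := fun b s => Rejects r X b B → ∀ E ∈ s, Rejects r X (r (length r b + 1) E) B)
    hclosed h3 h4 h5 ha (fun b s t hst h hb E hE => h hb E (hst hE)) fun b hab D hDB hb => by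
      obtain ⟨C, hC, hacc | hacc⟩ := exists_approx_succ_mem_or_notMem h5 h6 hb {c | nbhd r c B ⊆ X}
      · refine ⟨C, hC, fun hrej => absurd (fun E hE => ?_) (hrej C (nbhd_mono hDB hC))⟩
        exact hacc E hE (mem_nbhd_approx (hE.2.trans (hC.2.trans hDB)))
      · refine ⟨C, hC, fun _ E hE => ?_⟩
        have hEB : E ≤ B := hE.2.trans (hC.2.trans hDB)
        exact (hB _ (h3.isInitial_approx_succ hab hE) ⟨E, mem_nbhd_approx hEB⟩).resolve_left
          (hacc E hE)
  exact ⟨C, hCB, haC, fun b hab hrej E hE => hC b hab ⟨E, hE⟩ hrej E hE⟩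

theorem nbhd_inter_eq_empty_of_rejects (h3 : AxiomA3 r) (hX : IsOpen[metricTopology r] X)
    (hCB : C ≤ B) (ha : Rejects r X a B)
    (hsucc : ∀ b, IsInitial r a b → Rejects r X b B →
      ∀ E ∈ nbhd r b C, Rejects r X (r (length r b + 1) E) B) :
    nbhd r a C ∩ X = ∅ := by
  refine Set.eq_empty_iff_forall_notMem.2 ?_
  rintro E ⟨⟨⟨j, rfl⟩, hEC⟩, hEX⟩
  have hrej : ∀ k, j ≤ k → Rejects r X (r k E) B := by
    intro k hjk
    induction k, hjk using Nat.le_induction with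
    | base => exact ha
    | succ k hjk ih =>
      have := hsucc (r k E) (isInitial_approx E hjk) ih E (mem_nbhd_approx hEC)
      rwa [h3.length_approx] at this
  obtain ⟨n, hn⟩ := h3.isOpen_metricTopology_iff.1 hX E hEX
  refine hrej (max n j) (le_max_right _ _) E (mem_nbhd_approx (hEC.trans hCB)) fun F hF => ?_
  exact hn F (h3.approx_eq_of_le (h3.mem_nbhd.1 hF).1 (le_max_left _ _))

theorem isRamsey_of_isOpen (hclosed : MetricallyClosed r) (h3 : AxiomA3 r)
    (h4 : AxiomA4 r leFin) (h5 : AxiomA5 r leFin) (h6 : AxiomA6 r leFin)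
    (hX : IsOpen[metricTopology r] X) : IsRamsey r X := by
  refine isRamsey_of_exists_le fun a A ha => ?_
  obtain ⟨B, hBA, haB, hB⟩ := exists_forall_accepts_or_rejects hclosed h3 h4 h5 ha X
  obtain hacc | hrej := hB a (isInitial_refl ha) haB
  · exact ⟨B, hBA, haB, Or.inl hacc⟩
  · obtain ⟨C, hCB, haC, hsucc⟩ := exists_forall_rejects_succ hclosed h3 h4 h5 h6 haB hB
    exact ⟨C, hCB.trans hBA, haC, Or.inr (nbhd_inter_eq_empty_of_rejects h3 hX hCB hrej hsucc)⟩

theorem exists_forall_lt_decides {X : ℕ → Set R} (hX : ∀ i, IsRamsey r (X i))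
    (hb : b ∈ approxBelow r B) (N : ℕ) :
    ∃ C ∈ nbhd r b B, ∀ i < N, Decides (nbhd r b C) (X i) := by
  induction N with
  | zero => exact ⟨hb.some, hb.some_mem, fun i hi => (i.not_lt_zero hi).elim⟩
  | succ N ih =>
    obtain ⟨C, hC, hdec⟩ := ih
    obtain ⟨D, hD, hdecN⟩ := hX N b C ⟨C, mem_nbhd_self hC⟩
    refine ⟨D, nbhd_subset_of_mem hC hD, fun i hi => ?_⟩
    obtain hi | rfl := Nat.lt_succ_iff_lt_or_eq.1 hi
    exacts [(hdec i hi).mono (nbhd_subset_of_mem hD), hdecN]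

theorem isRamsey_iUnion (hclosed : MetricallyClosed r) (h3 : AxiomA3 r) (h4 : AxiomA4 r leFin)
    (h5 : AxiomA5 r leFin) (h6 : AxiomA6 r leFin) {X : ℕ → Set R} (hX : ∀ i, IsRamsey r (X i)) :
    IsRamsey r (⋃ i, X i) := by
  refine isRamsey_of_exists_le fun a A ha => ?_
  obtain ⟨B, hBA, haB, hB⟩ := exists_fusion
    (P := fun b s => ∀ i < length r b + 1, Decides s (X i)) hclosed h3 h4 h5 ha
    (fun b s t hst h i hi => (h i hi).mono hst)
    fun b _ B _ hb => exists_forall_lt_decides hX hb _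
  let U : Set R := {C | ∃ k, nbhd r (r k C) B ⊆ ⋃ i, X i}
  have hU : IsOpen[metricTopology r] U :=
    h3.isOpen_metricTopology_iff.2 fun D ⟨k, hk⟩ => ⟨k, fun E hE => ⟨k, hE ▸ hk⟩⟩
  have hUX : ∀ C ∈ nbhd r a B, (C ∈ U ↔ C ∈ ⋃ i, X i) := by
    rintro C ⟨⟨j, rfl⟩, hCB⟩
    refine ⟨fun ⟨k, hk⟩ => hk (mem_nbhd_approx hCB), fun hC => ?_⟩
    obtain ⟨i, hi⟩ := Set.mem_iUnion.1 hC
    have hdec : Decides (nbhd r (r (max i j) C) B) (X i) :=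
      hB _ (isInitial_approx C (le_max_right _ _)) ⟨C, mem_nbhd_approx hCB⟩ i
        (by rw [h3.length_approx]; omega)
    have hsub := hdec.resolve_right (Set.Nonempty.ne_empty ⟨C, mem_nbhd_approx hCB, hi⟩)
    exact ⟨max i j, hsub.trans (Set.subset_iUnion X i)⟩
  obtain ⟨C, hC, hdec⟩ := isRamsey_of_isOpen hclosed h3 h4 h5 h6 hU a B haB
  refine ⟨C, hC.2.trans hBA, ⟨C, mem_nbhd_self hC⟩, hdec.imp (fun h E hE => ?_) fun h => ?_⟩
  · exact (hUX E (nbhd_subset_of_mem hC hE)).1 (h hE)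
  · rw [← h]
    ext E
    exact and_congr_right fun hE => (hUX E (nbhd_subset_of_mem hC hE)).symm

end Preorder

end RamseySpace

theorem corollary3p4_general {R AR : Type*} [Preorder R] {r : ℕ → R → AR}
    {leFin : AR → AR → Prop} (hclosed : RamseySpace.MetricallyClosed r)
    (h3 : RamseySpace.AxiomA3 r) (h4 : RamseySpace.AxiomA4 r leFin)
    (h5 : RamseySpace.AxiomA5 r leFin) (h6 : RamseySpace.AxiomA6 r leFin) {X : Set R}
    (hX : RamseySpace.MetricBorel r X) : RamseySpace.IsRamsey r X := by
  induction X, hX using MeasurableSpace.generateFrom_induction with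
  | hC U hU => exact RamseySpace.isRamsey_of_isOpen hclosed h3 h4 h5 h6 hU
  | empty =>
    let _ := RamseySpace.metricTopology r
    exact RamseySpace.isRamsey_of_isOpen hclosed h3 h4 h5 h6 isOpen_empty
  | compl Y _ ih => exact ih.compl
  | iUnion Y _ ih => exact RamseySpace.isRamsey_iUnion hclosed h3 h4 h5 h6 ih

theorem corollary3p4 {R : Type*} {AR : Type*} [Preorder R] (r : ℕ → R → AR)
    (hr : Function.Surjective (Function.uncurry r))
    (hclosed : RamseySpace.MetricallyClosed r)
    (h1 : RamseySpace.AxiomA1 r) (h2 : RamseySpace.AxiomA2 r) (h3 : RamseySpace.AxiomA3 r)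
    (h456 : ∃ leFin : AR → AR → Prop, RamseySpace.AxiomA4 r leFin ∧
      RamseySpace.AxiomA5 r leFin ∧ RamseySpace.AxiomA6 r leFin)
    (X : Set R) (hX : RamseySpace.MetricBorel r X) :
    RamseySpace.IsRamsey r X := by
  obtain ⟨leFin, h4, h5, h6⟩ := h456
  exact corollary3p4_general hclosed h3 h4 h5 h6 hX
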